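/- Let $S=K[t_1,\ldots,t_s]$ be a polynomial ring over a finite field $K$ with the standard grading, let $\mathfrak{m}=(t_1,\ldots,t_s)$, and let $\prec$ be a graded monomial order on $S$ (monomials are first compared by total degree). Let $\mathbb{X}=\{[P_1],\ldots,[P_m]\}$ be a set of $m\ge 2$ distinct points of the projective space $\mathbb{P}^{s-1}$ over $K$, and let $I=I(\mathbb{X})$ be its graded vanishing ideal, generated by the homogeneous polynomials vanishing at all points of $\mathbb{X}$. Let $b_{i,j}$ be the graded Betti numbers of $S/I$, that is, $\bigoplus_j S(-j)^{b_{i,j}}$ is the $i$-th module of the minimal graded free resolution of $S/I$ over $S$; let $g=\max\{i\mid b_{i,j}\neq 0\text{ for some }j\}$ be the projective dimension of $S/I$, and let $r_0=\max\{j-i\mid b_{i,j}\ne 0\}$ be the Castelnuovo--Mumford regularity of $S/I$. The ideal $I$ is called Gorenstein if there is a unique $j$ with $b_{g,j}\neq 0$ and, for this $j$, $b_{g,j}=1$. For a graded ideal $L$ of $S$ let $\Delta_\prec(L)$ be the set of standard monomials of $S/L$, that is, the monomials not in the initial ideal ${\rm in}_\prec(L)$, let $\Delta_\prec(L)_d$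 be the set of those of degree $d$, and let $K\Delta_\prec(L)$ be the $K$-linear span of $\Delta_\prec(L)$. The remainder on division of $f\in S$ by $L$ is the unique $r_f\in K\Delta_\prec(L)$ with $f-r_f\in L$. For each $i$ let $\mathfrak{p}_i$ be the vanishing ideal of $[P_i]$, let ${\rm v}_{\mathfrak{p}_i}(I)$ be the least $d\ge 0$ such that $(I\colon f)=\mathfrak{p}_i$ for some homogeneous $f$ of degree $d$, and let $f_i$ be the $i$-th standard indicator function of $\mathbb{X}$, that is, the (unique up to a nonzero scalar) homogeneous polynomial $f_i\in K\Delta_\prec(I)$ of degree ${\rm v}_{\mathfrak{p}_i}(I)$ with $f_i(P_i)\ne 0$ and $f_i(P_j)=0$ for all $j\neq i$. Let $h$ be a homogeneous polynomial of degree $1$ that is regular on $S/I$, let $J=(I,h)$, and let ${\rm Soc}(S/J)=(J\colon\mathfrak{m})/J$. If $I$ is Gorenstein, then there is a monomial $t^a$ such that $\Delta_\prec(J)_{r_0}=\{t^a\}$, and for every $i=1,\ldots,m$ one has $\deg(f_i)=r_0$, $${\rm Soc}(S/J)=K(f_i+J)=K(t^a+J),$$ and the remainder on division of $f_i$ by $J$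 is $r_{f_i}=\lambda_i t^a$ for some $\lambda_i\in K\setminus\{0\}$. -/

import Mathlib

open scoped LinearAlgebra.Projectivization

noncomputable section

namespace ProjPoints

open MvPolynomial

variable {K : Type*} [Field K] {s m : ℕ}

/-! ### Points of projective space and their vanishing ideals -/

/-- The graded vanishing ideal of a set `X` of points of the projective space of dimension `s - 1`:
the ideal generated by the homogeneous polynomials that vanish at all points of `X`. The vanishing
of a homogeneous polynomial does not depend on the chosen representative. -/
def vanishingIdeal (X : Set (ℙ K (Fin s → K))) : Ideal (MvPolynomial (Fin s) K) :=
  Ideal.span {f | (∃ d, f.IsHomogeneous d) ∧ ∀ p ∈ X, eval p.rep f = 0}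

/-- The local v-number of `I` at `𝔭`: the least `d` such that `(I : f) = 𝔭` for some form `f` of
degree `d`. -/
def vNumber (I 𝔭 : Ideal (MvPolynomial (Fin s) K)) : ℕ :=
  sInf {d | ∃ f : MvPolynomial (Fin s) K, f.IsHomogeneous d ∧ Submodule.colon I {f} = 𝔭}

/-- `f` is an indicator function of the `i`-th point of the family `P`. -/
def IsIndicator (P : Fin m → ℙ K (Fin s → K)) (i : Fin m) (f : MvPolynomial (Fin s) K) : Prop :=
  (∃ d, f.IsHomogeneous d) ∧ eval (P i).rep f ≠ 0 ∧ ∀ j, j ≠ i → eval (P j).rep f = 0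

/-! ### Initial ideals, footprints and remainders -/

/-- A monomial order is graded if monomials are first compared by their total degrees. -/
def IsGradedOrder (ord : MonomialOrder (Fin s)) : Prop :=
  ∀ a b : Fin s →₀ ℕ, a.degree < b.degree → ord.toSyn a < ord.toSyn b

/-- The initial ideal, generated by the initial monomials of the nonzero elements of `I`. -/
def initialIdeal (ord : MonomialOrder (Fin s)) (I : Ideal (MvPolynomial (Fin s) K)) :
    Ideal (MvPolynomial (Fin s) K) :=
  Ideal.span {u | ∃ f ∈ I, f ≠ 0 ∧ u = monomial (ord.degree f) 1}

/-- The footprint of `S/I`: the (exponents of the) monomials that are not in the initial ideal. -/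
def footprint (ord : MonomialOrder (Fin s)) (I : Ideal (MvPolynomial (Fin s) K)) :
    Set (Fin s →₀ ℕ) :=
  {a | monomial a (1 : K) ∉ initialIdeal ord I}

/-- The standard monomials of degree `d`. -/
def footprintDeg (ord : MonomialOrder (Fin s)) (I : Ideal (MvPolynomial (Fin s) K)) (d : ℕ) :
    Set (Fin s →₀ ℕ) :=
  {a | a ∈ footprint ord I ∧ a.degree = d}

/-- The `K`-linear span of the standard monomials. -/
def standardSpan (ord : MonomialOrder (Fin s)) (I : Ideal (MvPolynomial (Fin s) K)) :
    Submodule K (MvPolynomial (Fin s) K) :=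
  Submodule.span K ((fun a => monomial a (1 : K)) '' footprint ord I)

/-- `r` is a remainder on division of `f` by `I`: it lies in the span of the standard monomials
and `f = g + r` for some `g ∈ I`. -/
def IsRemainder (ord : MonomialOrder (Fin s)) (I : Ideal (MvPolynomial (Fin s) K))
    (f r : MvPolynomial (Fin s) K) : Prop :=
  r ∈ standardSpan ord I ∧ ∃ g ∈ I, f = g + r

/-- `f` is the standard indicator function of the `i`-th point of the family `P` (it is unique up
to a nonzero scalar): an indicator function that is a combination of standard monomials of `S/I`,
where `I` is the vanishing ideal of all the points, and whose degree is the v-number of `I` at the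
vanishing ideal of the `i`-th point. -/
def IsStandardIndicator (ord : MonomialOrder (Fin s)) (P : Fin m → ℙ K (Fin s → K)) (i : Fin m)
    (f : MvPolynomial (Fin s) K) : Prop :=
  IsIndicator P i f ∧ f ∈ standardSpan ord (vanishingIdeal (Set.range P)) ∧
    f.totalDegree = vNumber (vanishingIdeal (Set.range P)) (vanishingIdeal {P i})

/-! ### Minimal graded free resolutions, Betti numbers, regularity, Gorenstein ideals -/

/-- A (finite) minimal graded free resolution
`⋯ → F₂ → F₁ → F₀ = S → S/I → 0` of `S/I` for a proper graded ideal `I`, given by matrices: `Fᵢ` is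
the direct sum of the `S(-shift i k)` for `k < rank i`, and `d i` is the matrix of the map from
`Fᵢ₊₁` to `Fᵢ`. -/
structure MinGradedFreeResolution (I : Ideal (MvPolynomial (Fin s) K)) where
  rank : ℕ → ℕ
  shift : (i : ℕ) → Fin (rank i) → ℕ
  d : (i : ℕ) → Matrix (Fin (rank i)) (Fin (rank (i + 1))) (MvPolynomial (Fin s) K)
  /-- The length is finite. -/
  finite : ∃ N, ∀ i, N < i → rank i = 0
  /-- `F₀ = S`. -/
  rank_zero : rank 0 = 1
  shift_zero : ∀ k, shift 0 k = 0
  /-- The maps are homogeneous of degree zero. -/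
  homogeneous : ∀ i l k, d i l k ≠ 0 → shift i l ≤ shift (i + 1) k ∧
    (d i l k).IsHomogeneous (shift (i + 1) k - shift i l)
  /-- Minimality: all entries of the matrices are in the ideal generated by the variables. -/
  minimal : ∀ i l k, d i l k ∈ idealOfVars (Fin s) K
  /-- Exactness at `F₀ = S`: the image of `F₁` is `I`. -/
  exact_zero : ∀ f : MvPolynomial (Fin s) K, f ∈ I ↔ ∃ v, (d 0).mulVec v = fun _ => f
  /-- Exactness at `Fᵢ₊₁`. -/
  exact_succ : ∀ i v, (d i).mulVec v = 0 ↔ ∃ w, (d (i + 1)).mulVec w = v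

open Classical in
/-- The graded Betti number `b_{i,j}` of `S/I`: the number of summands `S(-j)` in the `i`-th
module of the minimal graded free resolution of `S/I`. As this resolution is unique up to
isomorphism, the choice does not matter. -/
def gradedBetti (I : Ideal (MvPolynomial (Fin s) K)) (i j : ℕ) : ℕ :=
  if h : Nonempty (MinGradedFreeResolution I) then
    (Finset.univ.filter fun k => h.some.shift i k = j).card
  else 0

/-- The projective dimension of `S/I`: the length of the minimal graded free resolution. -/
def projDim (I : Ideal (MvPolynomial (Fin s) K)) : ℕ :=
  sSup {i | ∃ j, gradedBetti I i j ≠ 0}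

/-- The Castelnuovo-Mumford regularity of `S/I`: the maximum of `j - i` over all `i`, `j` with
`b_{i,j} ≠ 0` (for these one has `i ≤ j`). -/
def regularity (I : Ideal (MvPolynomial (Fin s) K)) : ℕ :=
  sSup {n | ∃ i j, gradedBetti I i j ≠ 0 ∧ i + n = j}

/-- `S/I` is level: the last module of the minimal graded free resolution is generated in a single
degree. -/
def IsLevel (I : Ideal (MvPolynomial (Fin s) K)) : Prop :=
  ∃! j, gradedBetti I (projDim I) j ≠ 0

/-- `I` is Gorenstein: `S/I` is level and the only nonzero last graded Betti number is one. -/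
def IsGorenstein (I : Ideal (MvPolynomial (Fin s) K)) : Prop :=
  IsLevel I ∧ ∀ j, gradedBetti I (projDim I) j ≠ 0 → gradedBetti I (projDim I) j = 1

/-! ### The socle -/

/-- The socle `(J : 𝔪)/J` of `S/J`, where `𝔪` is the ideal generated by the variables. -/
def socle (J : Ideal (MvPolynomial (Fin s) K)) : Ideal (MvPolynomial (Fin s) K ⧸ J) :=
  Ideal.map (Ideal.Quotient.mk J)
    (Submodule.colon J (idealOfVars (Fin s) K : Set (MvPolynomial (Fin s) K)))

end ProjPoints

end

/-! Write `𝔪` for the ideal of the variables. Each `f i` is a nonzero socle element of `S/J`. Since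
`h` vanishes at no point, `X k * f i` agrees on all points with a scalar multiple of `h * f i`; and
if `f i` were in `J`, dividing by `h` would give an indicator function of smaller degree.
Interpolation with the `f i` and powers of `h` shows that `J` contains all forms of degree greater
than `d`, the maximum of the degrees of the `f i`.

The Gorenstein hypothesis has to be turned into a statement about this socle. Classically, if `F` is
the minimal resolution of `S/I` and `n = s - 1`, then `F/hF` resolves `S/J` over `S/(h)`, and the
socle of `S/J`, shifted by `n`, is `Tor_n(S/J, K) = F_n/𝔪F_n`. The proof makes this elementary: `h`
and all variables except one generate `𝔪`. The resolution is reduced modulo these linear forms one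
at a time, and the connecting maps of the long exact homology sequences are followed through a
relation (`Correspondence`). This embeds the socle into `F_n/𝔪F_n`. The same sequences give `F_i =
0` for `i > n` and bound the shifts of `F_i` by `i + d`. All this is collected in
`socle_and_shifts`.

For a Gorenstein ideal `F_n` has rank one, so the socle is a line in a single degree. Hence all `f
i` have degree `d`, the last shift `n + d` attains the bound, and `d` is the regularity. As every
form of degree `d` is in the socle modulo `J`, the degree `d` part of `S/J` is that line, with
exactly one standard monomial; the remainder of `f i` is a nonzero multiple of it. -/

namespace ProjPoints

open MvPolynomial

variable {K : Type*} [Field K] {s : ℕ}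

/-! ### Graded components indexed by the integers -/

/-- The homogeneous component of degree `n`, for an integer `n`; it is zero if `n < 0`. -/
noncomputable def gradedComponent (n : ℤ) : MvPolynomial (Fin s) K →ₗ[K] MvPolynomial (Fin s) K :=
  if 0 ≤ n then homogeneousComponent n.toNat else 0

theorem coeff_gradedComponent (n : ℤ) (p : MvPolynomial (Fin s) K) (a : Fin s →₀ ℕ) :
    coeff a (gradedComponent n p) = if (a.degree : ℤ) = n then coeff a p else 0 := by
  unfold gradedComponent
  by_cases hn : 0 ≤ n
  · rw [if_pos hn, coeff_homogeneousComponent]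
    exact if_congr (by omega) rfl rfl
  · rw [if_neg hn, if_neg (by omega)]
    simp

theorem gradedComponent_natCast (n : ℕ) (p : MvPolynomial (Fin s) K) :
    gradedComponent (n : ℤ) p = homogeneousComponent n p := by
  simp [gradedComponent]

theorem gradedComponent_gradedComponent (n : ℤ) (p : MvPolynomial (Fin s) K) :
    gradedComponent n (gradedComponent n p) = gradedComponent n p := by
  ext a
  simp only [coeff_gradedComponent]
  split_ifs <;> rfl

theorem gradedComponent_mul {p : MvPolynomial (Fin s) K} {e : ℕ} (hp : p.IsHomogeneous e) (n : ℤ)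
    (q : MvPolynomial (Fin s) K) :
    gradedComponent n (p * q) = p * gradedComponent (n - e) q := by
  ext a
  rw [coeff_gradedComponent, coeff_mul, coeff_mul]
  trans ∑ x ∈ Finset.HasAntidiagonal.antidiagonal a, if (a.degree : ℤ) = n then coeff x.1 p * coeff x.2 q else 0
  · split_ifs <;> simp
  refine Finset.sum_congr rfl fun x hx => ?_
  rw [coeff_gradedComponent]
  by_cases h0 : coeff x.1 p = 0
  · simp [h0]
  have h1 : x.1.degree = e := by
    by_contra h
    exact h0 (hp.coeff_eq_zero h)
  have h2 : a.degree = x.1.degree + x.2.degree := by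
    rw [← Finset.HasAntidiagonal.mem_antidiagonal.1 hx, map_add]
  rw [mul_ite, mul_zero]
  exact if_congr (by omega) rfl rfl

theorem gradedComponent_eq_self_iff {n : ℕ} {p : MvPolynomial (Fin s) K} :
    gradedComponent (n : ℤ) p = p ↔ p.IsHomogeneous n := by
  rw [gradedComponent_natCast]
  exact ⟨fun h => h ▸ homogeneousComponent_isHomogeneous n p, homogeneousComponent_eq_self⟩

/-- An ideal is graded if it contains the graded components of its elements. -/
def IsGradedIdeal (L : Ideal (MvPolynomial (Fin s) K)) : Prop :=
  ∀ (n : ℤ) (p : MvPolynomial (Fin s) K), p ∈ L → gradedComponent n p ∈ L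

theorem isGradedIdeal_span {B : Set (MvPolynomial (Fin s) K)}
    (hB : ∀ b ∈ B, ∃ e, b.IsHomogeneous e) : IsGradedIdeal (Ideal.span B) := by
  intro n p hp
  rw [Ideal.span] at hp
  induction hp using Submodule.span_induction generalizing n with
  | zero => simp
  | add x y _ _ hx hy => rw [map_add]; exact add_mem (hx n) (hy n)
  | mem x hx =>
    obtain ⟨e, he⟩ := hB x hx
    rw [← mul_one x, gradedComponent_mul he]
    exact Ideal.mul_mem_right _ _ (Ideal.subset_span hx)
  | smul a x _ hx =>
    rw [← sum_homogeneousComponent a, Finset.sum_smul, map_sum]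
    refine sum_mem fun i _ => ?_
    rw [smul_eq_mul, gradedComponent_mul (homogeneousComponent_isHomogeneous i a)]
    exact Ideal.mul_mem_left _ _ (hx _)

theorem IsGradedIdeal.sup {L M : Ideal (MvPolynomial (Fin s) K)} (hL : IsGradedIdeal L)
    (hM : IsGradedIdeal M) : IsGradedIdeal (L ⊔ M) := by
  intro n p hp
  obtain ⟨x, hx, y, hy, rfl⟩ := Submodule.mem_sup.1 hp
  rw [map_add]
  exact Submodule.add_mem_sup (hL n x hx) (hM n y hy)

theorem IsGradedIdeal.sup_span_singleton {L : Ideal (MvPolynomial (Fin s) K)}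
    (hL : IsGradedIdeal L) {l : MvPolynomial (Fin s) K} {e : ℕ} (hl : l.IsHomogeneous e) :
    IsGradedIdeal (L ⊔ Ideal.span {l}) :=
  hL.sup (isGradedIdeal_span (by rintro b rfl; exact ⟨e, hl⟩))

/-- The family of the graded components of degree `j - a k` of the entries of a vector. -/
noncomputable def shiftedComponent {r : ℕ} (a : Fin r → ℕ) (j : ℤ) :
    (Fin r → MvPolynomial (Fin s) K) →ₗ[K] (Fin r → MvPolynomial (Fin s) K) :=
  LinearMap.pi fun k => gradedComponent (j - a k) ∘ₗ LinearMap.proj k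

theorem shiftedComponent_apply {r : ℕ} (a : Fin r → ℕ) (j : ℤ)
    (v : Fin r → MvPolynomial (Fin s) K) (k : Fin r) :
    shiftedComponent a j v k = gradedComponent (j - a k) (v k) := rfl

theorem shiftedComponent_shiftedComponent {r : ℕ} (a : Fin r → ℕ) (j : ℤ)
    (v : Fin r → MvPolynomial (Fin s) K) :
    shiftedComponent a j (shiftedComponent a j v) = shiftedComponent a j v := by
  funext k
  simp only [shiftedComponent_apply, gradedComponent_gradedComponent]

theorem shiftedComponent_smul {r : ℕ} (a : Fin r → ℕ) (j : ℤ) {l : MvPolynomial (Fin s) K}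
    (hl : l.IsHomogeneous 1) (v : Fin r → MvPolynomial (Fin s) K) :
    shiftedComponent a j (l • v) = l • shiftedComponent a (j - 1) v := by
  funext k
  simp only [shiftedComponent_apply, Pi.smul_apply, smul_eq_mul, gradedComponent_mul hl]
  congr 2
  push_cast
  ring_nf

/-- A vector that is congruent to zero modulo `L + (l)` is congruent to a multiple of `l`
modulo `L`. -/
theorem exists_smul_sub_mem {r : ℕ} {L : Ideal (MvPolynomial (Fin s) K)}
    {l : MvPolynomial (Fin s) K} {v : Fin r → MvPolynomial (Fin s) K}
    (hv : ∀ k, v k ∈ L ⊔ Ideal.span {l}) :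
    ∃ w : Fin r → MvPolynomial (Fin s) K, ∀ k, (v - l • w) k ∈ L := by
  have h (k : Fin r) : ∃ y, v k - l * y ∈ L := by
    obtain ⟨x, hx, y, hy, h'⟩ := Submodule.mem_sup.1 (hv k)
    obtain ⟨z, rfl⟩ := Ideal.mem_span_singleton'.1 hy
    exact ⟨z, by rw [← h', mul_comm z]; simpa using hx⟩
  choose w hw using h
  exact ⟨w, hw⟩

/-! ### Homology of the resolution reduced modulo an ideal, degree by degree -/

namespace MinGradedFreeResolution

variable {I : Ideal (MvPolynomial (Fin s) K)} (F : MinGradedFreeResolution I)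

/-- The differentials are homogeneous of degree zero. -/
theorem shiftedComponent_mulVec (i : ℕ) (j : ℤ)
    (v : Fin (F.rank (i + 1)) → MvPolynomial (Fin s) K) :
    shiftedComponent (F.shift i) j ((F.d i).mulVec v) =
      (F.d i).mulVec (shiftedComponent (F.shift (i + 1)) j v) := by
  funext l
  simp only [shiftedComponent_apply, Matrix.mulVec, dotProduct, map_sum]
  refine Finset.sum_congr rfl fun k _ => ?_
  by_cases h0 : F.d i l k = 0
  · simp [h0]
  obtain ⟨h1, h2⟩ := F.homogeneous i l k h0
  rw [gradedComponent_mul h2]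
  congr 3
  push_cast [h1]
  ring

theorem mulVec_mulVec_eq_zero (i : ℕ) (v : Fin (F.rank (i + 2)) → MvPolynomial (Fin s) K) :
    (F.d i).mulVec ((F.d (i + 1)).mulVec v) = 0 :=
  (F.exact_succ i _).2 ⟨v, rfl⟩

theorem mulVec_mem (L : Ideal (MvPolynomial (Fin s) K)) (i : ℕ)
    {v : Fin (F.rank (i + 1)) → MvPolynomial (Fin s) K} (hv : ∀ k, v k ∈ L) (l : Fin (F.rank i)) :
    (F.d i).mulVec v l ∈ L := by
  rw [Matrix.mulVec, dotProduct]
  exact Ideal.sum_mem L fun k _ => L.mul_mem_left (F.d i l k) (hv k)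

/-- `v` is a cycle of the reduction modulo `L` of the resolution. -/
def IsCycle (L : Ideal (MvPolynomial (Fin s) K)) :
    (i : ℕ) → (Fin (F.rank i) → MvPolynomial (Fin s) K) → Prop
  | 0, _ => True
  | i + 1, v => ∀ l, (F.d i).mulVec v l ∈ L

/-- `v` is a boundary of the reduction modulo `L` of the resolution. -/
def IsBoundary (L : Ideal (MvPolynomial (Fin s) K)) (i : ℕ)
    (v : Fin (F.rank i) → MvPolynomial (Fin s) K) : Prop :=
  ∃ u, ∀ l, (v - (F.d i).mulVec u) l ∈ L

/-- The homology of the reduction modulo `L` of the resolution vanishes at the position `i` and in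
the degree `j`. -/
def HomologyVanishes (L : Ideal (MvPolynomial (Fin s) K)) (i : ℕ) (j : ℤ) : Prop :=
  ∀ v, shiftedComponent (F.shift i) j v = v → F.IsCycle L i v → F.IsBoundary L i v

variable {F} {L : Ideal (MvPolynomial (Fin s) K)} {l : MvPolynomial (Fin s) K}

theorem IsBoundary.exists_homogeneous (hL : IsGradedIdeal L) {i : ℕ} {j : ℤ}
    {v : Fin (F.rank i) → MvPolynomial (Fin s) K} (hv : shiftedComponent (F.shift i) j v = v)
    (h : F.IsBoundary L i v) :
    ∃ u, shiftedComponent (F.shift (i + 1)) j u = u ∧ ∀ l, (v - (F.d i).mulVec u) l ∈ L := by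
  obtain ⟨u, hu⟩ := h
  refine ⟨shiftedComponent (F.shift (i + 1)) j u, shiftedComponent_shiftedComponent _ _ _, ?_⟩
  intro l
  rw [← F.shiftedComponent_mulVec, ← hv, ← map_sub, shiftedComponent_apply]
  exact hL _ _ (hu l)

/-- If `l` is regular modulo `L` and `d v` is congruent to `l w` modulo `L`, where `w` is a
boundary modulo `L`, then `v` is a boundary modulo `L + (l)`. -/
theorem isBoundary_of_mulVec_sub_smul_mem (hL : IsGradedIdeal L) (hl : l.IsHomogeneous 1)
    {i : ℕ} {j : ℤ} (hvan : F.HomologyVanishes L (i + 1) j)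
    {v : Fin (F.rank (i + 1)) → MvPolynomial (Fin s) K}
    (hv : shiftedComponent (F.shift (i + 1)) j v = v)
    {w : Fin (F.rank i) → MvPolynomial (Fin s) K}
    (hw : shiftedComponent (F.shift i) (j - 1) w = w)
    (hvw : ∀ k, ((F.d i).mulVec v - l • w) k ∈ L) (hb : F.IsBoundary L i w) :
    F.IsBoundary (L ⊔ Ideal.span {l}) (i + 1) v := by
  obtain ⟨x, hx, hwx⟩ := hb.exists_homogeneous hL hw
  -- If `w` is congruent to `d x`, then `v - l x` is a cycle modulo `L`, hence a boundary; the
  -- correction `l x` is zero modulo `L + (l)`.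
  obtain ⟨u, hu⟩ := hvan (v - l • x)
    (by rw [map_sub, hv, shiftedComponent_smul _ _ hl, hx]) (by
      intro k
      have := L.add_mem (hvw k) (L.mul_mem_left l (hwx k))
      rw [Matrix.mulVec_sub, Matrix.mulVec_smul]
      convert this using 1
      simp only [Pi.sub_apply, Pi.smul_apply, smul_eq_mul]
      ring)
  refine ⟨u, fun k => ?_⟩
  have h1 : l * x k ∈ Ideal.span {l} := Ideal.mul_mem_right _ _ (Ideal.mem_span_singleton_self l)
  convert Submodule.add_mem_sup (hu k) h1 using 1
  simp only [Pi.sub_apply, Pi.smul_apply, smul_eq_mul]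
  ring

theorem exists_homogeneous_mulVec_sub_smul_mem (hL : IsGradedIdeal L) (hl : l.IsHomogeneous 1)
    {i : ℕ} {j : ℤ} {v : Fin (F.rank (i + 1)) → MvPolynomial (Fin s) K}
    (hv : shiftedComponent (F.shift (i + 1)) j v = v)
    {w : Fin (F.rank i) → MvPolynomial (Fin s) K}
    (hw : ∀ k, ((F.d i).mulVec v - l • w) k ∈ L) (k : Fin (F.rank i)) :
    ((F.d i).mulVec v - l • shiftedComponent (F.shift i) (j - 1) w) k ∈ L := by
  rw [← shiftedComponent_smul _ _ hl, ← hv, ← F.shiftedComponent_mulVec, ← map_sub,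
    shiftedComponent_apply]
  exact hL _ _ (hw k)

/-- Applying the differential once more gives `l * d w ∈ L`, and `l` can be cancelled. Thus the
connecting map takes values in cycles. -/
theorem isCycle_of_mulVec_sub_smul_mem (hreg : ∀ x, l * x ∈ L → x ∈ L) {i : ℕ}
    {v : Fin (F.rank (i + 1)) → MvPolynomial (Fin s) K}
    {w : Fin (F.rank i) → MvPolynomial (Fin s) K}
    (hw : ∀ k, ((F.d i).mulVec v - l • w) k ∈ L) : F.IsCycle L i w := by
  match i with
  | 0 => trivial
  | i + 1 =>
    intro k
    have := F.mulVec_mem L i hw k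
    rw [Matrix.mulVec_sub, Matrix.mulVec_smul, F.mulVec_mulVec_eq_zero] at this
    apply hreg
    simpa using this

/-- This is the exact sequence `H_{i+1}(F/L)_j → H_{i+1}(F/(L + (l)))_j → H_i(F/L)_{j-1}`, whose
outer terms are zero; the degree drops by one because `l` is linear. -/
theorem HomologyVanishes.sup_span_singleton (hL : IsGradedIdeal L) (hl : l.IsHomogeneous 1)
    (hreg : ∀ x, l * x ∈ L → x ∈ L) {i : ℕ} {j : ℤ} (h1 : F.HomologyVanishes L (i + 1) j)
    (h0 : F.HomologyVanishes L i (j - 1)) :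
    F.HomologyVanishes (L ⊔ Ideal.span {l}) (i + 1) j := by
  intro v hv hc
  obtain ⟨w, hw⟩ := exists_smul_sub_mem hc
  have hw' := exists_homogeneous_mulVec_sub_smul_mem hL hl hv hw
  have hww := shiftedComponent_shiftedComponent (F.shift i) (j - 1) w
  exact isBoundary_of_mulVec_sub_smul_mem hL hl h1 hv hww hw'
    (h0 _ hww (isCycle_of_mulVec_sub_smul_mem hreg hw'))

theorem HomologyVanishes.zero_mono {M : Ideal (MvPolynomial (Fin s) K)} (hLM : L ≤ M) {j : ℤ}
    (h : F.HomologyVanishes L 0 j) : F.HomologyVanishes M 0 j := by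
  intro v hv _
  obtain ⟨u, hu⟩ := h v hv trivial
  exact ⟨u, fun k => hLM (hu k)⟩

end MinGradedFreeResolution

/-! ### Following socle elements through the connecting maps -/

namespace MinGradedFreeResolution

variable {I : Ideal (MvPolynomial (Fin s) K)} (F : MinGradedFreeResolution I)

/-- A graded correspondence of degree `k` between the elements of `S/J` annihilated by `A` and the
homology at the position `k` of the reduction modulo `L` of the resolution: it induces an injective
map from the former to the latter. -/
structure Correspondence (J L : Ideal (MvPolynomial (Fin s) K)) (k : ℕ)
    (A : Set (MvPolynomial (Fin s) K)) where
  rel : Submodule (MvPolynomial (Fin s) K)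
    (MvPolynomial (Fin s) K × (Fin (F.rank k) → MvPolynomial (Fin s) K))
  -- `isBoundary` says that the induced map is well defined, `mem` that it is injective, and
  -- `exists_rel` that it is defined on everything annihilated by `A`. The degree rises by `k`, one
  -- for each linear form used.
  graded : ∀ (e : ℤ) f v, (f, v) ∈ rel →
    (gradedComponent e f, shiftedComponent (F.shift k) (e + k) v) ∈ rel
  isBoundary : ∀ (e : ℤ) f v, gradedComponent e f = f →
    shiftedComponent (F.shift k) (e + k) v = v → (f, v) ∈ rel → f ∈ J → F.IsBoundary L k v
  mem : ∀ f v, (f, v) ∈ rel → F.IsBoundary L k v → f ∈ J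
  exists_rel : ∀ (e : ℤ) f, gradedComponent e f = f → (∀ l ∈ A, l * f ∈ J) →
    ∃ v, shiftedComponent (F.shift k) (e + k) v = v ∧ (f, v) ∈ rel

theorem rank_zero_pos : 0 < F.rank 0 := F.rank_zero ▸ one_pos

variable {F} in
theorem eq_of_rank_zero (k k' : Fin (F.rank 0)) : k = k' := by
  have h := F.rank_zero
  exact Fin.ext (by omega)

variable {F} {J L : Ideal (MvPolynomial (Fin s) K)} {l : MvPolynomial (Fin s) K}

/-- The relation at the next position: `f` is related to `v` if `f` is related to some `w` such
that `d v` is congruent to `l w` modulo `L`. -/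
noncomputable def nextRel (L : Ideal (MvPolynomial (Fin s) K)) (l : MvPolynomial (Fin s) K) {k : ℕ}
    (R : Submodule (MvPolynomial (Fin s) K)
      (MvPolynomial (Fin s) K × (Fin (F.rank k) → MvPolynomial (Fin s) K))) :
    Submodule (MvPolynomial (Fin s) K)
      (MvPolynomial (Fin s) K × (Fin (F.rank (k + 1)) → MvPolynomial (Fin s) K)) where
  carrier := {x | ∃ w, (x.1, w) ∈ R ∧ ∀ i, ((F.d k).mulVec x.2 - l • w) i ∈ L}
  zero_mem' := ⟨0, R.zero_mem, by simp⟩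
  add_mem' := by
    rintro ⟨f, v⟩ ⟨f', v'⟩ ⟨w, h, hw⟩ ⟨w', h', hw'⟩
    refine ⟨w + w', R.add_mem h h', fun i => ?_⟩
    have h2 : (F.d k).mulVec (v + v') - l • (w + w') =
        ((F.d k).mulVec v - l • w) + ((F.d k).mulVec v' - l • w') := by
      rw [Matrix.mulVec_add, smul_add]
      abel
    change ((F.d k).mulVec (v + v') - l • (w + w')) i ∈ L
    rw [h2]
    exact L.add_mem (hw i) (hw' i)
  smul_mem' := by
    rintro c ⟨f, v⟩ ⟨w, h, hw⟩
    have h1 : (c • f, c • w) ∈ R := by simpa only [Prod.smul_mk] using R.smul_mem c h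
    refine ⟨c • w, h1, fun i => ?_⟩
    change ((F.d k).mulVec (c • v) - l • (c • w)) i ∈ L
    rw [Matrix.mulVec_smul, smul_comm l c, ← smul_sub]
    exact L.mul_mem_left c (hw i)

/-- The correspondence at the next position. -/
noncomputable def Correspondence.next {k : ℕ} {A : Set (MvPolynomial (Fin s) K)}
    (R : F.Correspondence J L k A) (hL : IsGradedIdeal L)
    (hl : l.IsHomogeneous 1) (hreg : ∀ x, l * x ∈ L → x ∈ L)
    (hvan : ∀ j, F.HomologyVanishes L (k + 1) j) :
    F.Correspondence J (L ⊔ Ideal.span {l}) (k + 1) (insert l A) where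
  rel := nextRel L l R.rel
  graded := by
    rintro e f v ⟨w, h, hw⟩
    refine ⟨_, R.graded e f w h, fun i => ?_⟩
    have he : e + ((k + 1 : ℕ) : ℤ) - 1 = e + k := by push_cast; ring
    have := hL (e + ((k + 1 : ℕ) : ℤ) - F.shift k i) _ (hw i)
    rwa [← shiftedComponent_apply (F.shift k), map_sub,
      F.shiftedComponent_mulVec, shiftedComponent_smul _ _ hl, he] at this
  isBoundary := by
    rintro e f v hf hv ⟨w, h, hw⟩ hfJ
    have he : e + ((k + 1 : ℕ) : ℤ) - 1 = e + k := by push_cast; ring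
    have hw' := exists_homogeneous_mulVec_sub_smul_mem hL hl hv hw
    have hww := shiftedComponent_shiftedComponent (F.shift k) (e + k) w
    have h' := R.graded e f w h
    rw [hf] at h'
    rw [he] at hw'
    exact isBoundary_of_mulVec_sub_smul_mem hL hl (hvan _) hv (by rw [he, hww]) hw'
      (R.isBoundary e f _ hf hww h' hfJ)
  mem := by
    rintro f v ⟨w, h, hw⟩ ⟨u, hu⟩
    -- Modulo `L`, `v - d u` is `l x`, so `d v` is both `l w` and `l * d x`; cancelling `l` makes
    -- `w` the boundary of `x`.
    obtain ⟨x, hx⟩ := exists_smul_sub_mem hu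
    refine R.mem f w h ⟨x, fun i => hreg _ ?_⟩
    have h2 : l • (w - (F.d k).mulVec x) =
        (F.d k).mulVec (v - (F.d (k + 1)).mulVec u - l • x) - ((F.d k).mulVec v - l • w) := by
      rw [Matrix.mulVec_sub, Matrix.mulVec_sub, Matrix.mulVec_smul, F.mulVec_mulVec_eq_zero,
        smul_sub]
      abel
    change (l • (w - (F.d k).mulVec x)) i ∈ L
    rw [h2]
    exact L.sub_mem (F.mulVec_mem L k hx i) (hw i)
  exists_rel := by
    intro e f hf hA
    obtain ⟨w, hw, hR⟩ := R.exists_rel e f hf fun a ha => hA a (Set.mem_insert_of_mem _ ha)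
    have he : e + 1 + k - 1 = e + k := by ring
    have hlw : shiftedComponent (F.shift k) (e + 1 + k) (l • w) = l • w := by
      rw [shiftedComponent_smul _ _ hl, he, hw]
    have hlf : gradedComponent (e + 1) (l * f) = l * f := by
      rw [gradedComponent_mul hl, Nat.cast_one, add_sub_cancel_right, hf]
    have hlR : (l • f, l • w) ∈ R.rel := by
      simpa only [Prod.smul_mk] using R.rel.smul_mem l hR
    rw [smul_eq_mul] at hlR
    -- Since `l * f ∈ J`, the class of `l w` is zero; any homogeneous `v` with `d v` congruent to `l
    -- w` represents the inverse image of the class of `w` under the connecting map.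
    obtain ⟨v, hv, hb⟩ := (R.isBoundary (e + 1) (l * f) (l • w) hlf hlw hlR
      (hA l (Set.mem_insert _ _))).exists_homogeneous hL hlw
    refine ⟨v, ?_, w, hR, fun i => ?_⟩
    · rwa [show e + ((k + 1 : ℕ) : ℤ) = e + 1 + k by push_cast; ring]
    · rw [← neg_sub]
      exact L.neg_mem (hb i)

/-- The correspondence at the position zero, where `J = I + (l)`. -/
noncomputable def Correspondence.zero (F : MinGradedFreeResolution I) (l : MvPolynomial (Fin s) K) :
    F.Correspondence (I ⊔ Ideal.span {l}) (Ideal.span {l}) 0 ∅ where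
  rel := (LinearMap.pi fun _ => LinearMap.id :
    MvPolynomial (Fin s) K →ₗ[MvPolynomial (Fin s) K]
      (Fin (F.rank 0) → MvPolynomial (Fin s) K)).graph
  graded := by
    rintro e f v h
    rw [LinearMap.mem_graph_iff] at h ⊢
    obtain rfl : v = fun _ => f := h
    funext k
    simp [shiftedComponent_apply, F.shift_zero]
  isBoundary := by
    rintro e f v - - h hf
    obtain rfl : v = fun _ => f := (LinearMap.mem_graph_iff _ (f, v)).1 h
    obtain ⟨x, hx, y, hy, h⟩ := Submodule.mem_sup.1 hf
    obtain ⟨u, hu⟩ := (F.exact_zero x).1 hx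
    refine ⟨u, fun k => ?_⟩
    convert hy using 1
    rw [Pi.sub_apply, hu, ← h]
    simp
  mem := by
    rintro f v h ⟨u, hu⟩
    obtain rfl : v = fun _ => f := (LinearMap.mem_graph_iff _ (f, v)).1 h
    have hr := F.rank_zero_pos
    have hx : (F.d 0).mulVec u ⟨0, hr⟩ ∈ I := by
      refine (F.exact_zero _).2 ⟨u, funext fun k => congrArg _ (eq_of_rank_zero _ _)⟩
    convert Submodule.add_mem_sup hx (hu ⟨0, hr⟩) using 1
    simp
  exists_rel := by
    intro e f hf _
    refine ⟨fun _ => f, ?_, (LinearMap.mem_graph_iff _ (f, fun _ => f)).2 rfl⟩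
    funext k
    simp [shiftedComponent_apply, F.shift_zero, hf]

theorem homologyVanishes_bot (F : MinGradedFreeResolution I) (i : ℕ) (j : ℤ) :
    F.HomologyVanishes ⊥ (i + 1) j := by
  intro v _ hc
  obtain ⟨w, hw⟩ := (F.exact_succ i v).1 (funext fun k => by simpa using hc k)
  exact ⟨w, fun k => by simp [hw]⟩

/-- Since `h` will be regular on both `S` and `S/I`, reduction modulo it keeps the complex acyclic
in positive positions; this is the statement for `l`. -/
theorem homologyVanishes_span_singleton (F : MinGradedFreeResolution I) (hl : l.IsHomogeneous 1)
    (hl0 : l ≠ 0) (hreg : ∀ x, l * x ∈ I → x ∈ I) (i : ℕ) (j : ℤ) :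
    F.HomologyVanishes (Ideal.span {l}) (i + 1) j := by
  have hbot : IsGradedIdeal (⊥ : Ideal (MvPolynomial (Fin s) K)) := by
    intro n p hp
    simp [(Submodule.mem_bot _).1 hp]
  have hbr : ∀ x, l * x ∈ (⊥ : Ideal (MvPolynomial (Fin s) K)) →
      x ∈ (⊥ : Ideal (MvPolynomial (Fin s) K)) := by
    intro x hx
    simpa [hl0] using hx
  rw [← bot_sup_eq (Ideal.span {l})]
  match i with
  | i + 1 =>
    exact (F.homologyVanishes_bot (i + 1) j).sup_span_singleton hbot hl hbr
      (F.homologyVanishes_bot i _)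
  | 0 =>
    -- At position one the general step fails, as `H_0(F) = S/I` need not vanish. Instead `d v = l
    -- w` puts `l w` in `I`, so regularity on `S/I` puts `w` in `I` and makes it a boundary.
    intro v hv hc
    obtain ⟨w, hw⟩ := exists_smul_sub_mem hc
    have hw' := exists_homogeneous_mulVec_sub_smul_mem hbot hl hv hw
    refine isBoundary_of_mulVec_sub_smul_mem hbot hl (F.homologyVanishes_bot 0 j) hv
      (shiftedComponent_shiftedComponent _ _ _) hw' ?_
    generalize shiftedComponent (F.shift 0) (j - 1) w = w at hw'
    have hr := F.rank_zero_pos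
    have hx : l * w ⟨0, hr⟩ ∈ I := by
      refine (F.exact_zero _).2 ⟨v, funext fun k => ?_⟩
      have := hw' k
      rw [Submodule.mem_bot, Pi.sub_apply, sub_eq_zero] at this
      rw [this, eq_of_rank_zero k ⟨0, hr⟩]
      rfl
    obtain ⟨u, hu⟩ := (F.exact_zero _).1 (hreg _ hx)
    exact ⟨u, fun k => by rw [Pi.sub_apply, hu, eq_of_rank_zero k ⟨0, hr⟩]; simp⟩

/-- If the graded pieces of `S/(I + (l))` in the degree `j` are zero, the homology at the position
zero of the reduction modulo `l` vanishes in that degree. -/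
theorem homologyVanishes_zero (F : MinGradedFreeResolution I) {j : ℤ}
    (h : ∀ f, gradedComponent j f = f → f ∈ I ⊔ Ideal.span {l}) :
    F.HomologyVanishes (Ideal.span {l}) 0 j := by
  intro v hv _
  have hr := F.rank_zero_pos
  have h0 : gradedComponent j (v ⟨0, hr⟩) = v ⟨0, hr⟩ := by
    have := congrFun hv ⟨0, hr⟩
    rwa [shiftedComponent_apply, F.shift_zero, Nat.cast_zero, sub_zero] at this
  obtain ⟨x, hx, y, hy, hxy⟩ := Submodule.mem_sup.1 (h _ h0)
  obtain ⟨u, hu⟩ := (F.exact_zero x).1 hx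
  refine ⟨u, fun k => ?_⟩
  rw [Pi.sub_apply, hu, eq_of_rank_zero k ⟨0, hr⟩, ← hxy]
  simpa using hy

end MinGradedFreeResolution

/-! ### A linear form and the variables -/

/-- The ideal is monomial, and multiplying a monomial by `X j` with `j ∉ A` creates no new divisor
among the variables of `A`. -/
theorem mem_span_X_image_of_X_mul_mem {A : Set (Fin s)} {j : Fin s} (hj : j ∉ A)
    {x : MvPolynomial (Fin s) K} (hx : X j * x ∈ Ideal.span (X '' A : Set (MvPolynomial (Fin s) K))) :
    x ∈ Ideal.span (X '' A : Set (MvPolynomial (Fin s) K)) := by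
  rw [mem_ideal_span_X_image] at hx ⊢
  intro a ha
  obtain ⟨i, hi, h⟩ := hx (Finsupp.single j 1 + a) (by
    rw [mem_support_iff, coeff_X_mul]
    exact mem_support_iff.1 ha)
  have hij : j ≠ i := fun h => hj (h ▸ hi)
  exact ⟨i, hi, by simpa [Finsupp.single_apply, hij] using h⟩

/-- A nonzero linear form can be eliminated: there are an index `i₀` and a retraction of the
polynomial ring that fixes the other variables and whose kernel is generated by the form. -/
theorem exists_retraction {h : MvPolynomial (Fin s) K} (hh : h.IsHomogeneous 1) (h0 : h ≠ 0) :
    ∃ (i₀ : Fin s) (π : MvPolynomial (Fin s) K →ₐ[K] MvPolynomial (Fin s) K),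
      (∀ k, k ≠ i₀ → π (X k) = X k) ∧ π h = 0 ∧
      (∀ x, x - π x ∈ Ideal.span {h}) ∧
      π (X i₀) ∈ Ideal.span (X '' {k | k ≠ i₀} : Set (MvPolynomial (Fin s) K)) := by
  classical
  obtain ⟨c, rfl⟩ : ∃ c : Fin s → K, ∑ k, c k • (X k : MvPolynomial (Fin s) K) = h := by
    rw [← Submodule.mem_span_range_iff_exists_fun, ← homogeneousSubmodule_one_eq_span_X]
    exact hh
  obtain ⟨i₀, hi₀⟩ : ∃ i, c i ≠ 0 := by
    by_contra! hc
    exact h0 (by simp [hc])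
  let y : MvPolynomial (Fin s) K := -∑ k ∈ Finset.univ.erase i₀, ((c i₀)⁻¹ * c k) • X k
  let π : MvPolynomial (Fin s) K →ₐ[K] MvPolynomial (Fin s) K :=
    aeval fun k => if k = i₀ then y else X k
  have hπ (k) (hk : k ≠ i₀) : π (X k) = X k := by simp [π, hk]
  have hπ₀ : π (X i₀) = y := by simp [π]
  have hy : ∑ k, c k • (X k : MvPolynomial (Fin s) K) = c i₀ • (X i₀ - y) := by
    rw [← Finset.add_sum_erase _ _ (Finset.mem_univ i₀), sub_neg_eq_add, smul_add,
      Finset.smul_sum]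
    simp only [smul_smul, mul_inv_cancel_left₀ hi₀]
  have hyy : π y = y := by
    simp only [y, map_neg, map_sum, map_smul]
    congr 1
    exact Finset.sum_congr rfl fun k hk => by rw [hπ k (Finset.ne_of_mem_erase hk)]
  refine ⟨i₀, π, hπ, ?_, fun x => ?_, ?_⟩
  · rw [hy, map_smul, map_sub, hyy, hπ₀, sub_self, smul_zero]
  -- The quotient map and its composite with `π` are algebra maps, so it suffices to compare them on
  -- the variables.
  · rw [← Ideal.Quotient.eq]
    change Ideal.Quotient.mkₐ K _ x = ((Ideal.Quotient.mkₐ K _).comp π) x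
    refine congrArg (fun φ : MvPolynomial (Fin s) K →ₐ[K] _ => φ x)
      (MvPolynomial.algHom_ext fun k => ?_)
    by_cases hk : k = i₀
    · subst hk
      rw [AlgHom.comp_apply, hπ₀, Ideal.Quotient.mkₐ_eq_mk, Ideal.Quotient.eq, hy,
        Ideal.mem_span_singleton]
      refine ⟨C (c k)⁻¹, ?_⟩
      rw [mul_comm, ← smul_eq_C_mul, smul_smul, inv_mul_cancel₀ hi₀, one_smul]
    · rw [AlgHom.comp_apply, hπ k hk]
  · rw [hπ₀]
    refine neg_mem (Ideal.sum_mem _ fun k hk => ?_)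
    rw [smul_eq_C_mul]
    exact Ideal.mul_mem_left _ _ (Ideal.subset_span ⟨k, Finset.ne_of_mem_erase hk, rfl⟩)

/-- Eliminating `X i₀` identifies `S/(h)` with the polynomial ring in the other variables, where
these form a regular sequence in any order. -/
theorem exists_regular_variables {h : MvPolynomial (Fin s) K} (hh : h.IsHomogeneous 1)
    (h0 : h ≠ 0) : ∃ i₀ : Fin s,
      (∀ (A : Set (Fin s)) (j : Fin s), i₀ ∉ A → j ∉ A → j ≠ i₀ → ∀ x,
        X j * x ∈ Ideal.span {h} ⊔ Ideal.span (X '' A) → x ∈ Ideal.span {h} ⊔ Ideal.span (X '' A)) ∧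
      Ideal.span {h} ⊔ Ideal.span (X '' {k | k ≠ i₀}) = idealOfVars (Fin s) K := by
  obtain ⟨i₀, π, hπ, hπh, hx, hi₀⟩ := exists_retraction hh h0
  refine ⟨i₀, fun A j hA hj hji x hjx => ?_, le_antisymm ?_ ?_⟩
  · have h1 : π (X j * x) ∈ Ideal.span (X '' A : Set (MvPolynomial (Fin s) K)) := by
      have := Ideal.mem_map_of_mem π hjx
      refine (?_ : Ideal.map π _ ≤ _) this
      rw [Ideal.map_sup, Ideal.map_span, Ideal.map_span, Set.image_singleton, hπh, sup_le_iff]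
      refine ⟨by simp, Ideal.span_le.2 ?_⟩
      rintro _ ⟨_, ⟨k, hk, rfl⟩, rfl⟩
      rw [hπ k fun h => hA (h ▸ hk)]
      exact Ideal.subset_span ⟨k, hk, rfl⟩
    rw [map_mul, hπ j hji] at h1
    rw [← sub_add_cancel x (π x)]
    exact Submodule.add_mem_sup (hx x) (mem_span_X_image_of_X_mul_mem hj h1)
  · rw [sup_le_iff]
    refine ⟨(Ideal.span_singleton_le_iff_mem _).2 ?_, Ideal.span_mono (Set.image_subset_range _ _)⟩
    have h1 : h ∈ Submodule.span K (Set.range X) :=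
      homogeneousSubmodule_one_eq_span_X (σ := Fin s) (R := K) ▸ hh
    exact Submodule.span_le_restrictScalars K (MvPolynomial (Fin s) K) _ h1
  · rw [Ideal.span_le]
    rintro _ ⟨k, rfl⟩
    by_cases hk : k = i₀
    · subst hk
      rw [SetLike.mem_coe, ← sub_add_cancel (X k) (π (X k))]
      exact Submodule.add_mem_sup (hx _) hi₀
    · exact Ideal.mem_sup_right (Ideal.subset_span ⟨k, hk, rfl⟩)

theorem coeff_zero_eq_zero_of_mem_idealOfVars {p : MvPolynomial (Fin s) K}
    (hp : p ∈ idealOfVars (Fin s) K) : coeff 0 p = 0 := by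
  rw [idealOfVars, ← Set.image_univ, mem_ideal_span_X_image] at hp
  by_contra h
  obtain ⟨i, -, hi⟩ := hp 0 (mem_support_iff.2 h)
  exact hi rfl

theorem mem_idealOfVars_of_coeff_zero_eq_zero {p : MvPolynomial (Fin s) K}
    (hp : coeff 0 p = 0) : p ∈ idealOfVars (Fin s) K := by
  rw [idealOfVars, ← Set.image_univ, mem_ideal_span_X_image]
  intro a ha
  by_contra! h
  obtain rfl : a = 0 := Finsupp.ext fun i => h i trivial
  exact mem_support_iff.1 ha hp

/-! ### Reduction modulo all variables: shifts and socle -/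

namespace MinGradedFreeResolution

variable {I : Ideal (MvPolynomial (Fin s) K)} {h : MvPolynomial (Fin s) K}

/-- The reductions of the resolution modulo a regular linear form `h` and all variables. -/
theorem exists_correspondence (F : MinGradedFreeResolution I) (hh : h.IsHomogeneous 1) (h0 : h ≠ 0)
    (hreg : ∀ x, h * x ∈ I → x ∈ I) {D : ℤ}
    (hD : ∀ (j : ℤ) f, D < j → gradedComponent j f = f → f ∈ I ⊔ Ideal.span {h}) :
    ∃ n : ℕ,
      (∃ A, Nonempty (F.Correspondence (I ⊔ Ideal.span {h}) (idealOfVars (Fin s) K) n (X '' A))) ∧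
      (∀ (i : ℕ) (j : ℤ), n < i → F.HomologyVanishes (idealOfVars (Fin s) K) i j) ∧
      ∀ (i : ℕ) (j : ℤ), i + D < j → F.HomologyVanishes (idealOfVars (Fin s) K) i j := by
  classical
  obtain ⟨i₀, hx, htop⟩ := exists_regular_variables hh h0
  -- Adjoining the variables of `A` one by one; the correspondence needs the vanishing beyond
  -- `A.card` at each step, so the claims go together. With all variables but `X i₀`, the ideal
  -- becomes `idealOfVars`.
  have key (A : Finset (Fin s)) (hA : i₀ ∉ A) :
      Nonempty (F.Correspondence (I ⊔ Ideal.span {h})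
        (Ideal.span {h} ⊔ Ideal.span (X '' (A : Set (Fin s)))) A.card (X '' (A : Set (Fin s)))) ∧
      (∀ (i : ℕ) (j : ℤ), A.card < i →
        F.HomologyVanishes (Ideal.span {h} ⊔ Ideal.span (X '' (A : Set (Fin s)))) i j) ∧
      ∀ (i : ℕ) (j : ℤ), i + D < j →
        F.HomologyVanishes (Ideal.span {h} ⊔ Ideal.span (X '' (A : Set (Fin s)))) i j := by
    induction A using Finset.induction_on with
    | empty =>
      have hs : Ideal.span {h} ⊔ Ideal.span (X '' ((∅ : Finset (Fin s)) : Set (Fin s))) =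
          Ideal.span {h} := by simp
      rw [hs, Finset.card_empty, Finset.coe_empty, Set.image_empty]
      have hv (i : ℕ) (j : ℤ) (hi : 0 < i) : F.HomologyVanishes (Ideal.span {h}) i j := by
        obtain ⟨i, rfl⟩ := Nat.exists_eq_succ_of_ne_zero hi.ne'
        exact F.homologyVanishes_span_singleton hh h0 hreg i j
      refine ⟨⟨Correspondence.zero F h⟩, hv, fun i j hij => ?_⟩
      rcases Nat.eq_zero_or_pos i with rfl | hi
      · exact F.homologyVanishes_zero fun f hf => hD j f (by simpa using hij) hf
      · exact hv i j hi
    | insert a A ha ih =>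
      obtain ⟨⟨R⟩, hV, hR⟩ := ih fun h => hA (Finset.mem_insert_of_mem h)
      have hi₀ : i₀ ∉ A := fun h => hA (Finset.mem_insert_of_mem h)
      have hai : a ≠ i₀ := fun h => hA (h ▸ Finset.mem_insert_self _ _)
      have hs : Ideal.span {h} ⊔ Ideal.span (X '' ((insert a A : Finset (Fin s)) : Set (Fin s))) =
          (Ideal.span {h} ⊔ Ideal.span (X '' (A : Set (Fin s)))) ⊔
            Ideal.span {(X a : MvPolynomial (Fin s) K)} := by
        rw [Finset.coe_insert, Set.image_insert_eq, Ideal.span_insert, sup_assoc,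
          sup_comm (Ideal.span {X a})]
      have hL : IsGradedIdeal (Ideal.span {h} ⊔ Ideal.span (X '' (A : Set (Fin s)))) := by
        refine (isGradedIdeal_span ?_).sup (isGradedIdeal_span ?_)
        · rintro _ rfl
          exact ⟨1, hh⟩
        · rintro _ ⟨k, -, rfl⟩
          exact ⟨1, isHomogeneous_X _ _⟩
      have hr := hx A a (by simpa using hi₀) (by simpa using ha) hai
      rw [hs, Finset.card_insert_of_notMem ha, Finset.coe_insert, Set.image_insert_eq]
      refine ⟨⟨R.next hL (isHomogeneous_X _ _) hr fun j => hV _ j (Nat.lt_succ_self _)⟩, ?_, ?_⟩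
      · intro i j hi
        obtain ⟨i, rfl⟩ := Nat.exists_eq_succ_of_ne_zero (Nat.ne_zero_of_lt hi)
        exact (hV _ _ (by omega)).sup_span_singleton hL (isHomogeneous_X _ _) hr (hV _ _ (by omega))
      · intro i j hij
        match i with
        | 0 => exact (hR 0 j hij).zero_mono le_sup_left
        | i + 1 =>
          push_cast at hij
          exact (hR _ _ (by push_cast; omega)).sup_span_singleton hL (isHomogeneous_X _ _) hr
            (hR _ _ (by omega))
  obtain ⟨hR, hV, hW⟩ := key (Finset.univ.erase i₀) (Finset.notMem_erase _ _)
  have hset : ((Finset.univ.erase i₀ : Finset (Fin s)) : Set (Fin s)) = {k | k ≠ i₀} := by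
    ext k
    simp
  rw [hset, htop] at hR hV hW
  exact ⟨_, ⟨_, hR⟩, hV, hW⟩

variable (F : MinGradedFreeResolution I)

/-- No element of the standard basis is a boundary modulo the variables. -/
theorem not_isBoundary_single (i : ℕ) (k : Fin (F.rank i)) :
    ¬ F.IsBoundary (idealOfVars (Fin s) K) i (Pi.single k 1) := by
  rintro ⟨u, hu⟩
  have h1 := hu k
  have h2 : (F.d i).mulVec u k ∈ idealOfVars (Fin s) K := by
    rw [Matrix.mulVec, dotProduct]
    exact Ideal.sum_mem _ fun l _ => Ideal.mul_mem_right _ _ (F.minimal i k l)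
  have h3 := coeff_zero_eq_zero_of_mem_idealOfVars (Ideal.add_mem _ h1 h2)
  simp at h3

theorem isBoundary_of_mem {L : Ideal (MvPolynomial (Fin s) K)} {i : ℕ}
    {v : Fin (F.rank i) → MvPolynomial (Fin s) K} (hv : ∀ k, v k ∈ L) : F.IsBoundary L i v :=
  ⟨0, by simpa using hv⟩

theorem isCycle_idealOfVars (i : ℕ) (v : Fin (F.rank i) → MvPolynomial (Fin s) K) :
    F.IsCycle (idealOfVars (Fin s) K) i v := by
  match i with
  | 0 => trivial
  | i + 1 =>
    intro k
    rw [Matrix.mulVec, dotProduct]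
    exact Ideal.sum_mem _ fun l _ => Ideal.mul_mem_right _ _ (F.minimal i k l)

/-- By minimality all differentials are zero modulo the variables, so each basis element is a
nonzero class in the degree of its shift. Vanishing of homology thus bounds ranks and shifts. -/
theorem not_homologyVanishes_shift (i : ℕ) (k : Fin (F.rank i)) :
    ¬ F.HomologyVanishes (idealOfVars (Fin s) K) i (F.shift i k) := by
  intro hv
  refine F.not_isBoundary_single i k (hv _ ?_ (F.isCycle_idealOfVars i _))
  funext l
  rw [shiftedComponent_apply]
  rcases eq_or_ne l k with rfl | hl
  · rw [Pi.single_eq_same, sub_self]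
    exact gradedComponent_eq_self_iff (n := 0).2 (isHomogeneous_one _ _)
  · rw [Pi.single_eq_of_ne hl, map_zero]

/-- A homogeneous vector of degree `j` with constant terms zero in the summands generated in degree
`j` has its entries in the ideal of the variables. -/
theorem apply_mem_idealOfVars_of_ne {i : ℕ} {j : ℤ} {v : Fin (F.rank i) → MvPolynomial (Fin s) K}
    (hv : shiftedComponent (F.shift i) j v = v) {k : Fin (F.rank i)} (hk : (F.shift i k : ℤ) ≠ j) :
    v k ∈ idealOfVars (Fin s) K := by
  apply mem_idealOfVars_of_coeff_zero_eq_zero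
  rw [← hv, shiftedComponent_apply, coeff_gradedComponent, if_neg]
  simp only [map_zero, Nat.cast_zero]
  omega

/-- The numerical consequences for the resolution of `S/I` of a regular linear form `h`, where the
graded pieces of `S/(I + (h))` are zero in all degrees greater than `D`, if `S/(I + (h))` has a
homogeneous socle element: the projective dimension is `n`, the shifts are bounded, and if the last
module is free of rank one, the socle is of dimension one, in the degree given by the last shift. -/
theorem socle_and_shifts (hh : h.IsHomogeneous 1) (h0 : h ≠ 0)
    (hreg : ∀ x, h * x ∈ I → x ∈ I) {D : ℤ}
    (hD : ∀ (j : ℤ) f, D < j → gradedComponent j f = f → f ∈ I ⊔ Ideal.span {h}) :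
    ∃ n : ℕ, (∀ i, n < i → F.rank i = 0) ∧ (∀ i k, (F.shift i k : ℤ) ≤ i + D) ∧
      (∀ (e : ℤ) f, gradedComponent e f = f → (∀ i, X i * f ∈ I ⊔ Ideal.span {h}) →
        f ∉ I ⊔ Ideal.span {h} → ∃ k, (F.shift n k : ℤ) = e + n) ∧
      (F.rank n = 1 → ∀ (e : ℤ) f g, gradedComponent e f = f → gradedComponent e g = g →
        (∀ i, X i * f ∈ I ⊔ Ideal.span {h}) → (∀ i, X i * g ∈ I ⊔ Ideal.span {h}) →
        g ∉ I ⊔ Ideal.span {h} → ∃ c : K, f - c • g ∈ I ⊔ Ideal.span {h}) := by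
  obtain ⟨n, ⟨A, ⟨R⟩⟩, hV, hW⟩ := F.exists_correspondence hh h0 hreg hD
  have hA {f : MvPolynomial (Fin s) K} (hf : ∀ i, X i * f ∈ I ⊔ Ideal.span {h}) :
      ∀ l ∈ (X '' A : Set (MvPolynomial (Fin s) K)), l * f ∈ I ⊔ Ideal.span {h} := by
    rintro _ ⟨i, -, rfl⟩
    exact hf i
  refine ⟨n, fun i hi => ?_, fun i k => ?_, fun e f hf hs hfJ => ?_, fun hr e f g hf hg hsf hsg hgJ
    => ?_⟩
  · by_contra h
    exact F.not_homologyVanishes_shift i ⟨0, Nat.pos_of_ne_zero h⟩ (hV i _ hi)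
  · by_contra! h
    exact F.not_homologyVanishes_shift i k (hW i _ h)
  · obtain ⟨v, hv, hR⟩ := R.exists_rel e f hf (hA hs)
    by_contra! hk
    -- If no shift equals `e + n`, all entries of `v` lie in the ideal of the variables; then the
    -- class of `v` is zero and injectivity gives `f ∈ J`.
    exact hfJ (R.mem f v hR (F.isBoundary_of_mem fun k => F.apply_mem_idealOfVars_of_ne hv (hk k)))
  · obtain ⟨v, hv, hRf⟩ := R.exists_rel e f hf (hA hsf)
    obtain ⟨w, hw, hRg⟩ := R.exists_rel e g hg (hA hsg)
    have h0 : 0 < F.rank n := hr ▸ one_pos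
    have hk (k : Fin (F.rank n)) : k = ⟨0, h0⟩ := Fin.ext (by have := k.2; simp only; omega)
    have hw0 : coeff 0 (w ⟨0, h0⟩) ≠ 0 := by
      intro hc
      refine hgJ (R.mem g w hRg (F.isBoundary_of_mem fun k => ?_))
      rw [hk k]
      exact mem_idealOfVars_of_coeff_zero_eq_zero hc
    -- In rank one a class is its constant term; this scalar cancels that of `v - c w`.
    refine ⟨coeff 0 (v ⟨0, h0⟩) / coeff 0 (w ⟨0, h0⟩), ?_⟩
    generalize hc : coeff 0 (v ⟨0, h0⟩) / coeff 0 (w ⟨0, h0⟩) = c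
    rw [smul_eq_C_mul]
    have hRc : (f - C c * g, v - (C c : MvPolynomial (Fin s) K) • w) ∈ R.rel := by
      simpa only [Prod.smul_mk, Prod.mk_sub_mk, smul_eq_mul] using
        R.rel.sub_mem hRf (R.rel.smul_mem (C c) hRg)
    refine R.mem _ _ hRc (F.isBoundary_of_mem fun k => ?_)
    rw [hk k]
    apply mem_idealOfVars_of_coeff_zero_eq_zero
    rw [Pi.sub_apply, Pi.smul_apply, smul_eq_mul, coeff_sub, coeff_C_mul, ← hc,
      div_mul_cancel₀ _ hw0, sub_self]

end MinGradedFreeResolution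

variable {m : ℕ}

/-! ### Vanishing ideals and indicator functions -/

/-- Vanishing at a projective point is meaningful only for forms, so membership is tested on each
graded component. -/
theorem mem_vanishingIdeal_iff {Y : Set (ℙ K (Fin s → K))} {f : MvPolynomial (Fin s) K} :
    f ∈ vanishingIdeal Y ↔ ∀ (n : ℤ), ∀ p ∈ Y, eval p.rep (gradedComponent n f) = 0 := by
  constructor
  · intro hf n p hp
    rw [vanishingIdeal, Ideal.span] at hf
    induction hf using Submodule.span_induction generalizing n with
    | zero => simp
    | add x y _ _ hx hy => rw [map_add, map_add, hx, hy, add_zero]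
    | mem x hx =>
      obtain ⟨⟨d, hd⟩, hx⟩ := hx
      rw [← mul_one x, gradedComponent_mul hd, map_mul, hx p hp, zero_mul]
    | smul a x _ hx =>
      rw [← sum_homogeneousComponent a, Finset.sum_smul, map_sum, map_sum]
      refine Finset.sum_eq_zero fun i _ => ?_
      rw [smul_eq_mul, gradedComponent_mul (homogeneousComponent_isHomogeneous i a), map_mul, hx,
        mul_zero]
  · intro h
    rw [← sum_homogeneousComponent f]
    refine Ideal.sum_mem _ fun i _ => Ideal.subset_span
      ⟨⟨i, homogeneousComponent_isHomogeneous i f⟩, fun p hp => ?_⟩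
    rw [← gradedComponent_natCast]
    exact h i p hp

theorem mem_vanishingIdeal_iff_of_isHomogeneous {Y : Set (ℙ K (Fin s → K))}
    {f : MvPolynomial (Fin s) K} {d : ℕ} (hf : f.IsHomogeneous d) :
    f ∈ vanishingIdeal Y ↔ ∀ p ∈ Y, eval p.rep f = 0 := by
  refine ⟨fun h p hp => ?_, fun h => Ideal.subset_span ⟨⟨d, hf⟩, h⟩⟩
  rw [← gradedComponent_eq_self_iff.2 hf]
  exact mem_vanishingIdeal_iff.1 h d p hp

theorem isGradedIdeal_vanishingIdeal (Y : Set (ℙ K (Fin s → K))) :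
    IsGradedIdeal (vanishingIdeal Y) :=
  isGradedIdeal_span fun _ hb => hb.1

theorem colon_eq_vanishingIdeal_of_isIndicator {P : Fin m → ℙ K (Fin s → K)} {i : Fin m}
    {g : MvPolynomial (Fin s) K} (hg : IsIndicator P i g) :
    Submodule.colon (vanishingIdeal (Set.range P)) {g} = vanishingIdeal {P i} := by
  obtain ⟨⟨d, hd⟩, hi, hj⟩ := hg
  ext f
  rw [Submodule.mem_colon_singleton, smul_eq_mul, mul_comm, mem_vanishingIdeal_iff,
    mem_vanishingIdeal_iff]
  constructor
  · rintro h n p rfl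
    have := h (n + d) (P i) ⟨i, rfl⟩
    rw [gradedComponent_mul hd, map_mul, add_sub_cancel_right] at this
    exact (mul_eq_zero.1 this).resolve_left hi
  · rintro h n _ ⟨j, rfl⟩
    rw [gradedComponent_mul hd, map_mul]
    rcases eq_or_ne j i with rfl | hji
    · rw [h _ _ rfl, mul_zero]
    · rw [hj j hji, zero_mul]

theorem vNumber_le_of_isIndicator {P : Fin m → ℙ K (Fin s → K)} {i : Fin m}
    {g : MvPolynomial (Fin s) K} (hg : IsIndicator P i g) {d : ℕ} (hd : g.IsHomogeneous d) :
    vNumber (vanishingIdeal (Set.range P)) (vanishingIdeal {P i}) ≤ d :=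
  Nat.sInf_le ⟨g, hd, colon_eq_vanishingIdeal_of_isIndicator hg⟩

theorem IsIndicator.ne_zero {P : Fin m → ℙ K (Fin s → K)} {i : Fin m}
    {g : MvPolynomial (Fin s) K} (hg : IsIndicator P i g) : g ≠ 0 := by
  rintro rfl
  exact hg.2.1 (map_zero _)

theorem IsIndicator.isHomogeneous {P : Fin m → ℙ K (Fin s → K)} {i : Fin m}
    {g : MvPolynomial (Fin s) K} (hg : IsIndicator P i g) : g.IsHomogeneous g.totalDegree := by
  obtain ⟨d, hd⟩ := hg.1
  rwa [hd.totalDegree hg.ne_zero]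

theorem eval_ne_zero_of_regular {P : Fin m → ℙ K (Fin s → K)} {i : Fin m}
    {g h : MvPolynomial (Fin s) K} (hg : IsIndicator P i g) {e : ℕ} (hh : h.IsHomogeneous e)
    (hreg : ∀ x, h * x ∈ vanishingIdeal (Set.range P) → x ∈ vanishingIdeal (Set.range P)) :
    eval (P i).rep h ≠ 0 := by
  intro h0
  obtain ⟨⟨d, hd⟩, hi, hj⟩ := hg
  have h1 : h * g ∈ vanishingIdeal (Set.range P) := by
    rw [mem_vanishingIdeal_iff_of_isHomogeneous (hh.mul hd)]
    rintro _ ⟨j, rfl⟩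
    rw [map_mul]
    rcases eq_or_ne j i with rfl | hji
    · rw [h0, zero_mul]
    · rw [hj j hji, mul_zero]
  exact hi ((mem_vanishingIdeal_iff_of_isHomogeneous hd).1 (hreg _ h1) _ ⟨i, rfl⟩)

/-- Indicator functions are in the socle modulo a linear form that does not vanish at the point. -/
theorem X_mul_mem_of_isIndicator {P : Fin m → ℙ K (Fin s → K)} {i : Fin m}
    {g h : MvPolynomial (Fin s) K} (hg : IsIndicator P i g) (hh : h.IsHomogeneous 1)
    (hi : eval (P i).rep h ≠ 0) (k : Fin s) :
    X k * g ∈ vanishingIdeal (Set.range P) ⊔ Ideal.span {h} := by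
  obtain ⟨⟨d, hd⟩, -, hj⟩ := hg
  -- The scalar makes the linear factor vanish at the `i`-th point; `g` vanishes at all others.
  have h1 : (X k - C ((P i).rep k / eval (P i).rep h) * h) * g ∈
      vanishingIdeal (Set.range P) := by
    rw [mem_vanishingIdeal_iff_of_isHomogeneous
      (((isHomogeneous_X K k).sub (hh.C_mul _)).mul hd)]
    rintro _ ⟨j, rfl⟩
    rw [map_mul]
    rcases eq_or_ne j i with rfl | hji
    · simp [hi]
    · rw [hj j hji, mul_zero]
  have h2 : C ((P i).rep k / eval (P i).rep h) * g * h ∈ Ideal.span {h} :=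
    Ideal.mul_mem_left _ _ (Ideal.mem_span_singleton_self h)
  convert Submodule.add_mem_sup h1 h2 using 1
  ring

/-- An indicator function of the least possible degree is not zero modulo a regular linear form. -/
theorem notMem_of_isIndicator {P : Fin m → ℙ K (Fin s → K)} {i : Fin m}
    {g h : MvPolynomial (Fin s) K} (hg : IsIndicator P i g)
    (hdeg : g.totalDegree = vNumber (vanishingIdeal (Set.range P)) (vanishingIdeal {P i}))
    (hh : h.IsHomogeneous 1) (hP : ∀ j, eval (P j).rep h ≠ 0) :
    g ∉ vanishingIdeal (Set.range P) ⊔ Ideal.span {h} := by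
  intro hmem
  have hd := hg.isHomogeneous
  obtain ⟨x, hx, y, hy, hxy⟩ := Submodule.mem_sup.1 hmem
  obtain ⟨z, rfl⟩ := Ideal.mem_span_singleton'.1 hy
  have h1 := isGradedIdeal_vanishingIdeal _ (g.totalDegree : ℤ) _ hx
  rw [eq_sub_of_add_eq hxy, map_sub, gradedComponent_eq_self_iff.2 hd, mul_comm z,
    gradedComponent_mul hh] at h1
  obtain ⟨-, hi, hj⟩ := hg
  cases hn : g.totalDegree with
  | zero =>
    -- The component of degree `-1` is zero, so a constant `g` would lie in the vanishing ideal
    -- itself.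
    have hz : gradedComponent ((g.totalDegree : ℤ) - (1 : ℕ)) z = 0 := by
      rw [hn]
      simp [gradedComponent]
    rw [hz, mul_zero, sub_zero] at h1
    exact hi ((mem_vanishingIdeal_iff_of_isHomogeneous hd).1 h1 _ ⟨i, rfl⟩)
  | succ e =>
    have hz : (g.totalDegree : ℤ) - (1 : ℕ) = e := by
      rw [hn]
      push_cast
      ring
    rw [hz, gradedComponent_natCast] at h1
    have hw := homogeneousComponent_isHomogeneous e z
    generalize homogeneousComponent e z = w at h1 hw
    have hhw := hh.mul hw
    rw [add_comm, ← hn] at hhw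
    have h2 (j : Fin m) : eval (P j).rep g = eval (P j).rep h * eval (P j).rep w := by
      rw [← sub_eq_zero, ← map_mul, ← map_sub]
      exact (mem_vanishingIdeal_iff_of_isHomogeneous (hd.sub hhw)).1 h1 _ ⟨j, rfl⟩
    have hwi : IsIndicator P i w := by
      refine ⟨⟨e, hw⟩, fun h0 => hi ?_, fun j hji => ?_⟩
      · rw [h2, h0, mul_zero]
      · have := hj j hji
        rw [h2] at this
        exact (mul_eq_zero.1 this).resolve_left (hP j)
    have := vNumber_le_of_isIndicator hwi hw
    omega

/-- Modulo a linear form that does not vanish at the points, the forms of degree greater than the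
degrees of indicator functions of all points are zero. -/
theorem mem_of_totalDegree_lt {P : Fin m → ℙ K (Fin s → K)} {f : Fin m → MvPolynomial (Fin s) K}
    (hf : ∀ i, IsIndicator P i (f i)) {h : MvPolynomial (Fin s) K} (hh : h.IsHomogeneous 1)
    (hP : ∀ j, eval (P j).rep h ≠ 0) {j : ℕ} (hj : ∀ i, (f i).totalDegree < j)
    {g : MvPolynomial (Fin s) K} (hg : g.IsHomogeneous j) :
    g ∈ vanishingIdeal (Set.range P) ⊔ Ideal.span {h} := by
  -- Interpolation coefficients: `q` takes the values of `g` at all points, and each exponent of `h`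
  -- is positive.
  let c (i : Fin m) : K :=
    eval (P i).rep g / (eval (P i).rep h ^ (j - (f i).totalDegree) * eval (P i).rep (f i))
  let q := ∑ i, C (c i) * (h ^ (j - (f i).totalDegree) * f i)
  have hq : q.IsHomogeneous j := by
    refine IsHomogeneous.sum _ _ _ fun i _ => IsHomogeneous.C_mul ?_ _
    have := (hh.pow (j - (f i).totalDegree)).mul (hf i).isHomogeneous
    rwa [one_mul, Nat.sub_add_cancel (hj i).le] at this
  have hqh : q ∈ Ideal.span {h} := by
    refine Ideal.sum_mem _ fun i _ => Ideal.mul_mem_left _ _ (Ideal.mul_mem_right _ _ ?_)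
    exact Ideal.pow_mem_of_mem _ (Ideal.mem_span_singleton_self h) _ (Nat.sub_pos_of_lt (hj i))
  have hgq : g - q ∈ vanishingIdeal (Set.range P) := by
    rw [mem_vanishingIdeal_iff_of_isHomogeneous (hg.sub hq)]
    rintro _ ⟨k, rfl⟩
    rw [map_sub, map_sum, Finset.sum_eq_single k]
    · rw [map_mul, eval_C, map_mul, map_pow, div_mul_cancel₀, sub_self]
      exact mul_ne_zero (pow_ne_zero _ (hP k)) (hf k).2.1
    · intro i _ hik
      rw [map_mul, map_mul, (hf i).2.2 k hik.symm, mul_zero, mul_zero]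
    · intro hk
      exact absurd (Finset.mem_univ k) hk
  rw [← sub_add_cancel g q]
  exact Submodule.add_mem_sup hgq hqh

/-! ### Betti numbers -/

variable {I : Ideal (MvPolynomial (Fin s) K)}

/-- Without a resolution all Betti numbers default to zero, which contradicts the existence of a
nonzero last one. -/
theorem IsGorenstein.nonempty (hG : IsGorenstein I) : Nonempty (MinGradedFreeResolution I) := by
  by_contra h
  obtain ⟨j, hj, -⟩ := hG.1
  exact hj (by simp [gradedBetti, h])

theorem gradedBetti_eq [hne : Nonempty (MinGradedFreeResolution I)] (i j : ℕ) :
    gradedBetti I i j = (Finset.univ.filter fun k => hne.some.shift i k = j).card := by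
  simp only [gradedBetti, dif_pos hne]

theorem gradedBetti_ne_zero_iff [hne : Nonempty (MinGradedFreeResolution I)] {i j : ℕ} :
    gradedBetti I i j ≠ 0 ↔ ∃ k, hne.some.shift i k = j := by
  rw [gradedBetti_eq, Finset.card_ne_zero]
  simp [Finset.Nonempty]

theorem projDim_eq [hne : Nonempty (MinGradedFreeResolution I)] {n : ℕ}
    (hn : hne.some.rank n ≠ 0) (h : ∀ i, n < i → hne.some.rank i = 0) : projDim I = n := by
  refine IsGreatest.csSup_eq ⟨?_, ?_⟩
  · exact ⟨_, gradedBetti_ne_zero_iff.2 ⟨⟨0, Nat.pos_of_ne_zero hn⟩, rfl⟩⟩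
  · rintro i ⟨j, hj⟩
    obtain ⟨k, -⟩ := gradedBetti_ne_zero_iff.1 hj
    by_contra! hi
    have := k.2
    have := h i hi
    omega

/-- Levelness puts all generators of the last module in one degree, so the single Betti number there
counts all of them. -/
theorem IsGorenstein.rank_projDim (hG : IsGorenstein I)
    [hne : Nonempty (MinGradedFreeResolution I)] : hne.some.rank (projDim I) = 1 := by
  obtain ⟨⟨j, hj, hu⟩, h1⟩ := hG
  have h2 := h1 j hj
  rw [gradedBetti_eq, Finset.filter_true_of_mem, Finset.card_univ, Fintype.card_fin] at h2
  · exact h2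
  · exact fun k _ => hu _ (gradedBetti_ne_zero_iff.2 ⟨k, rfl⟩)

theorem regularity_eq [hne : Nonempty (MinGradedFreeResolution I)] {n d : ℕ}
    {k : Fin (hne.some.rank n)} (hk : hne.some.shift n k = n + d)
    (h : ∀ i l, hne.some.shift i l ≤ i + d) : regularity I = d := by
  refine IsGreatest.csSup_eq ⟨⟨n, n + d, gradedBetti_ne_zero_iff.2 ⟨k, hk⟩, rfl⟩, ?_⟩
  rintro e ⟨i, j, hij, he⟩
  obtain ⟨l, hl⟩ := gradedBetti_ne_zero_iff.1 hij
  have := h i l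
  omega

/-! ### Standard monomials -/

variable {ord : MonomialOrder (Fin s)} {J : Ideal (MvPolynomial (Fin s) K)}

theorem notMem_footprint_iff {a : Fin s →₀ ℕ} :
    a ∉ footprint ord J ↔ ∃ f ∈ J, f ≠ 0 ∧ ord.degree f ≤ a := by
  have h1 : initialIdeal ord J = Ideal.span ((fun a => monomial a (1 : K)) ''
      {b | ∃ f ∈ J, f ≠ 0 ∧ ord.degree f = b}) := by
    rw [initialIdeal]
    congr 1
    ext u
    simp only [Set.mem_ofPred_eq, Set.mem_image]
    constructor
    · rintro ⟨f, hf, h0, rfl⟩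
      exact ⟨_, ⟨f, hf, h0, rfl⟩, rfl⟩
    · rintro ⟨_, ⟨f, hf, h0, rfl⟩, rfl⟩
      exact ⟨f, hf, h0, rfl⟩
  rw [footprint, Set.mem_ofPred_eq, not_not, h1, mem_ideal_span_monomial_image]
  classical
  rw [support_monomial, if_neg one_ne_zero]
  simp only [Finset.mem_singleton, forall_eq]
  constructor
  · rintro ⟨_, ⟨f, hf, h0, rfl⟩, h⟩
    exact ⟨f, hf, h0, h⟩
  · rintro ⟨f, hf, h0, h⟩
    exact ⟨_, ⟨f, hf, h0, rfl⟩, h⟩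

theorem degree_notMem_footprint {f : MvPolynomial (Fin s) K} (hf : f ∈ J) (h0 : f ≠ 0) :
    ord.degree f ∉ footprint ord J :=
  notMem_footprint_iff.2 ⟨f, hf, h0, le_rfl⟩

theorem mem_standardSpan_iff {r : MvPolynomial (Fin s) K} :
    r ∈ standardSpan ord J ↔ ∀ a, coeff a r ≠ 0 → a ∈ footprint ord J := by
  classical
  constructor
  · intro hr
    induction hr using Submodule.span_induction with
    | zero => simp
    | add x y _ _ hx hy =>
      intro a ha
      by_cases hxa : coeff a x = 0
      · exact hy a fun h => ha (by rw [coeff_add, hxa, h, add_zero])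
      · exact hx a hxa
    | mem x hx =>
      obtain ⟨b, hb, rfl⟩ := hx
      intro a ha
      rw [coeff_monomial] at ha
      have : b = a := by
        by_contra h
        exact ha (if_neg h)
      exact this ▸ hb
    | smul c x _ hx =>
      intro a ha
      exact hx a fun h => ha (by rw [coeff_smul, h, smul_zero])
  · intro h
    rw [r.as_sum]
    refine sum_mem fun a ha => ?_
    rw [← mul_one (coeff a r), ← smul_eq_mul, ← smul_monomial]
    exact Submodule.smul_mem _ _ (Submodule.subset_span ⟨a, h a (mem_support_iff.1 ha), rfl⟩)

theorem eq_zero_of_mem_standardSpan {r : MvPolynomial (Fin s) K} (hr : r ∈ standardSpan ord J)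
    (hJ : r ∈ J) : r = 0 := by
  by_contra h0
  refine degree_notMem_footprint (ord := ord) hJ h0 (mem_standardSpan_iff.1 hr _ ?_)
  exact ord.coeff_degree_ne_zero_iff.2 h0

theorem monomial_notMem_of_mem_footprint {a : Fin s →₀ ℕ} (ha : a ∈ footprint ord J) :
    monomial a (1 : K) ∉ J := by
  intro h
  have := eq_zero_of_mem_standardSpan (ord := ord) (Submodule.subset_span ⟨a, ha, rfl⟩) h
  exact one_ne_zero (monomial_eq_zero.1 this)

theorem exists_isRemainder (ord : MonomialOrder (Fin s)) (J : Ideal (MvPolynomial (Fin s) K))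
    (f : MvPolynomial (Fin s) K) : ∃ r, IsRemainder ord J f r := by
  -- Dividing by all nonzero elements of `J` at once makes a Gröbner basis unnecessary.
  obtain ⟨g, r, hfr, -, hr⟩ := ord.div_set (B := {b | b ∈ J ∧ b ≠ 0})
    (fun b hb => (ord.leadingCoeff_ne_zero_iff.2 hb.2).isUnit) f
  refine ⟨r, mem_standardSpan_iff.2 fun a ha => ?_, _, ?_, hfr⟩
  · by_contra h
    obtain ⟨b, hb, h0, hba⟩ := notMem_footprint_iff.1 h
    exact hr a (mem_support_iff.2 ha) b ⟨hb, h0⟩ hba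
  · rw [Finsupp.linearCombination_apply]
    exact Ideal.sum_mem _ fun b _ => Ideal.mul_mem_left _ _ b.2.1

theorem IsRemainder.sub_mem {f r : MvPolynomial (Fin s) K} (h : IsRemainder ord J f r) :
    f - r ∈ J := by
  obtain ⟨-, g, hg, rfl⟩ := h
  simpa using hg

theorem isRemainder_iff_eq {f r : MvPolynomial (Fin s) K} (hr : r ∈ standardSpan ord J)
    (hfr : f - r ∈ J) (r' : MvPolynomial (Fin s) K) : IsRemainder ord J f r' ↔ r' = r := by
  constructor
  · intro h
    rw [← sub_eq_zero]
    refine eq_zero_of_mem_standardSpan (ord := ord) (Submodule.sub_mem _ h.1 hr) ?_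
    rw [← sub_sub_sub_cancel_left _ _ f]
    exact J.sub_mem hfr h.sub_mem
  · rintro rfl
    exact ⟨hr, _, hfr, (sub_add_cancel _ _).symm⟩

/-- If every form of degree `d` is modulo `J` a multiple of each form of degree `d` not in `J`,
and there is such a form, there is exactly one standard monomial of degree `d`. -/
theorem exists_footprintDeg_eq_singleton (hJ : IsGradedIdeal J) {d : ℕ}
    {f : MvPolynomial (Fin s) K} (hf : f.IsHomogeneous d) (hfJ : f ∉ J)
    (h : ∀ p g : MvPolynomial (Fin s) K, p.IsHomogeneous d → g.IsHomogeneous d → g ∉ J →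
      ∃ c : K, p - c • g ∈ J) :
    ∃ a, footprintDeg ord J d = {a} := by
  obtain ⟨r, hr⟩ := exists_isRemainder ord J f
  have h1 := hJ d _ hr.sub_mem
  rw [map_sub, gradedComponent_eq_self_iff.2 hf] at h1
  -- The remainder of `f` has a nonzero part of degree `d`, since otherwise `f ∈ J`.
  obtain ⟨a, ha⟩ : ∃ a, coeff a (gradedComponent (d : ℤ) r) ≠ 0 := by
    by_contra! h0
    have h2 : gradedComponent (d : ℤ) r = 0 := by
      ext a
      simpa using h0 a
    rw [h2, sub_zero] at h1
    exact hfJ h1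
  rw [coeff_gradedComponent] at ha
  have had : (a.degree : ℤ) = d := by
    by_contra h0
    exact ha (if_neg h0)
  rw [if_pos had] at ha
  have haf := mem_standardSpan_iff.1 hr.1 a ha
  refine ⟨a, Set.eq_singleton_iff_unique_mem.2 ⟨⟨haf, by exact_mod_cast had⟩, ?_⟩⟩
  rintro b ⟨hb, hbd⟩
  by_contra hab
  obtain ⟨c, hc⟩ := h (monomial b 1) (monomial a 1) (isHomogeneous_monomial _ hbd)
    (isHomogeneous_monomial _ (by exact_mod_cast had)) (monomial_notMem_of_mem_footprint haf)
  have h0 := eq_zero_of_mem_standardSpan (ord := ord) (Submodule.sub_mem _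
    (Submodule.subset_span ⟨b, hb, rfl⟩)
    (Submodule.smul_mem _ c (Submodule.subset_span ⟨a, haf, rfl⟩))) hc
  have h2 := congrArg (coeff b) h0
  classical
  simp [coeff_monomial, Ne.symm hab] at h2

/-! ### The socle -/

theorem mem_colon_idealOfVars_iff {p : MvPolynomial (Fin s) K} :
    p ∈ Submodule.colon J (idealOfVars (Fin s) K : Set (MvPolynomial (Fin s) K)) ↔
      ∀ i, X i * p ∈ J := by
  rw [idealOfVars, Ideal.colon_span, Submodule.mem_colon]
  simp [mul_comm]

/-- If the homogeneous elements of the socle are multiples of `g`, so are all its elements. -/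
theorem socle_eq_span (hJ : IsGradedIdeal J) {g : MvPolynomial (Fin s) K}
    (hg : ∀ i, X i * g ∈ J)
    (h : ∀ (e : ℕ) (f : MvPolynomial (Fin s) K), f.IsHomogeneous e → (∀ i, X i * f ∈ J) →
      ∃ c : K, f - c • g ∈ J) :
    (socle J).restrictScalars K = Submodule.span K {Ideal.Quotient.mk J g} := by
  apply le_antisymm
  · intro x hx
    rw [Submodule.restrictScalars_mem, socle,
      Ideal.mem_map_iff_of_surjective _ Ideal.Quotient.mk_surjective] at hx
    obtain ⟨p, hp, rfl⟩ := hx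
    rw [mem_colon_idealOfVars_iff] at hp
    rw [← sum_homogeneousComponent p, map_sum]
    refine sum_mem fun e _ => ?_
    obtain ⟨c, hc⟩ := h e _ (homogeneousComponent_isHomogeneous e p) fun i => by
      have := hJ ((e : ℤ) + 1) _ (hp i)
      rwa [gradedComponent_mul (isHomogeneous_X K i), Nat.cast_one, add_sub_cancel_right,
        gradedComponent_natCast] at this
    rw [Submodule.mem_span_singleton]
    exact ⟨c, (Ideal.Quotient.eq.2 hc).symm⟩
  · rw [Submodule.span_singleton_le_iff_mem, Submodule.restrictScalars_mem]
    exact Ideal.mem_map_of_mem _ (mem_colon_idealOfVars_iff.2 hg)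

end ProjPoints

/-! ### The main theorem -/

open ProjPoints MvPolynomial

theorem mainTheorem9 {K : Type*} [Field K] [Finite K] {s m : ℕ} (hm : 2 ≤ m)
    (ord : MonomialOrder (Fin s)) (hord : ProjPoints.IsGradedOrder ord)
    (P : Fin m → ℙ K (Fin s → K)) (hP : Function.Injective P)
    (I : Ideal (MvPolynomial (Fin s) K)) (hI : I = ProjPoints.vanishingIdeal (Set.range P))
    (hG : ProjPoints.IsGorenstein I)
    (h : MvPolynomial (Fin s) K) (hh : h.IsHomogeneous 1)
    (hreg : IsSMulRegular (MvPolynomial (Fin s) K ⧸ I) h)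
    (J : Ideal (MvPolynomial (Fin s) K)) (hJ : J = I ⊔ Ideal.span {h})
    (f : Fin m → MvPolynomial (Fin s) K)
    (hf : ∀ i, ProjPoints.IsStandardIndicator ord P i (f i)) :
    ∃ a : Fin s →₀ ℕ,
      ProjPoints.footprintDeg ord J (ProjPoints.regularity I) = {a} ∧
      (∀ i, (f i).totalDegree = ProjPoints.regularity I) ∧
      (∀ i, (ProjPoints.socle J).restrictScalars K =
        Submodule.span K {Ideal.Quotient.mk J (f i)}) ∧
      (ProjPoints.socle J).restrictScalars K =
        Submodule.span K {Ideal.Quotient.mk J (MvPolynomial.monomial a (1 : K))} ∧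
      ∀ i, ∃ c : K, c ≠ 0 ∧
        ∀ r, ProjPoints.IsRemainder ord J (f i) r ↔ r = MvPolynomial.monomial a c := by
  have hregI : ∀ x, h * x ∈ I → x ∈ I := by
    intro x hx
    rw [← Ideal.Quotient.eq_zero_iff_mem] at hx ⊢
    refine hreg ?_
    dsimp only
    rw [smul_zero, ← hx]
    rfl
  have hind (i : Fin m) : IsIndicator P i (f i) := (hf i).1
  have hP0 (i : Fin m) : eval (P i).rep h ≠ 0 :=
    eval_ne_zero_of_regular (hind i) hh (hI ▸ hregI)
  have hh0 : h ≠ 0 := by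
    rintro rfl
    exact hP0 ⟨0, by omega⟩ (map_zero _)
  have hJg : IsGradedIdeal J := by
    rw [hJ, hI]
    exact (isGradedIdeal_vanishingIdeal _).sup_span_singleton hh
  have hsoc (i : Fin m) (k : Fin s) : X k * f i ∈ J := by
    rw [hJ, hI]
    exact X_mul_mem_of_isIndicator (hind i) hh (hP0 i) k
  have hfJ (i : Fin m) : f i ∉ J := by
    rw [hJ, hI]
    exact notMem_of_isIndicator (hind i) (hf i).2.2 hh hP0
  have hdeg (i : Fin m) : gradedComponent ((f i).totalDegree : ℤ) (f i) = f i :=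
    gradedComponent_eq_self_iff.2 (hind i).isHomogeneous
  obtain ⟨i₀, -, hmax⟩ := Finset.exists_max_image Finset.univ (fun i => (f i).totalDegree)
    ⟨⟨0, by omega⟩, Finset.mem_univ _⟩
  obtain ⟨d, hd⟩ : ∃ d, (f i₀).totalDegree = d := ⟨_, rfl⟩
  have hle (i : Fin m) : (f i).totalDegree ≤ d := hd ▸ hmax i (Finset.mem_univ _)
  have htop (j : ℤ) (g : MvPolynomial (Fin s) K) (hj : (d : ℤ) < j)
      (hg : gradedComponent j g = g) : g ∈ J := by
    lift j to ℕ using by omega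
    rw [hJ, hI]
    exact mem_of_totalDegree_lt hind hh hP0 (fun i => lt_of_le_of_lt (hle i) (by omega))
      (gradedComponent_eq_self_iff.1 hg)
  have : Nonempty (MinGradedFreeResolution I) := hG.nonempty
  obtain ⟨n, hn, hshift, hex, hone⟩ :=
    MinGradedFreeResolution.socle_and_shifts this.some hh hh0 hregI (hJ ▸ htop)
  rw [← hJ] at hex hone
  -- The nonzero socle element `f i₀` forces the `n`-th module to be nonzero, so `n` is the
  -- projective dimension.
  have hrank : this.some.rank n = 1 := by
    obtain ⟨k, -⟩ := hex _ _ (hdeg i₀) (hsoc i₀) (hfJ i₀)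
    rw [← projDim_eq (Nat.ne_zero_of_lt k.2) hn]
    exact hG.rank_projDim
  obtain ⟨k₀, hk₀⟩ := hex _ _ (hdeg i₀) (hsoc i₀) (hfJ i₀)
  have hfd (i : Fin m) : (f i).totalDegree = d := by
    obtain ⟨k, hk⟩ := hex _ _ (hdeg i) (hsoc i) (hfJ i)
    -- There is only one shift at position `n`, so all nonzero homogeneous socle elements have the
    -- same degree.
    have hkk : k = k₀ := Fin.ext (by omega)
    rw [hkk] at hk
    omega
  have hreg_eq : regularity I = d := by
    refine regularity_eq (k := k₀) (by omega) fun i l => ?_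
    have := hshift i l
    omega
  have hsocd (g : MvPolynomial (Fin s) K) (hg : g.IsHomogeneous d) (k : Fin s) : X k * g ∈ J := by
    refine htop (1 + d : ℕ) _ (by omega) (gradedComponent_eq_self_iff.2 ?_)
    exact (isHomogeneous_X K k).mul hg
  have hfh (i : Fin m) : (f i).IsHomogeneous d := hfd i ▸ (hind i).isHomogeneous
  have hone' (e : ℕ) (p g : MvPolynomial (Fin s) K) (hp : p.IsHomogeneous e)
      (hsp : ∀ k, X k * p ∈ J) (hg : g.IsHomogeneous d) (hgJ : g ∉ J) :
      ∃ c : K, p - c • g ∈ J := by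
    by_cases hpe : e = d
    · subst hpe
      exact hone hrank e p g (gradedComponent_eq_self_iff.2 hp) (gradedComponent_eq_self_iff.2 hg)
        hsp (hsocd g hg) hgJ
    · refine ⟨0, ?_⟩
      rw [zero_smul, sub_zero]
      by_contra hpJ
      obtain ⟨k, hk⟩ := hex _ _ (gradedComponent_eq_self_iff.2 hp) hsp hpJ
      have hkk : k = k₀ := Fin.ext (by omega)
      rw [hkk] at hk
      omega
  have hspan (g : MvPolynomial (Fin s) K) (hg : g.IsHomogeneous d) (hgJ : g ∉ J) :
      (socle J).restrictScalars K = Submodule.span K {Ideal.Quotient.mk J g} :=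
    socle_eq_span hJg (hsocd g hg) fun e p hp hsp => hone' e p g hp hsp hg hgJ
  obtain ⟨a, ha⟩ := exists_footprintDeg_eq_singleton (ord := ord) hJg (hfh i₀) (hfJ i₀)
    fun p g hp hg hgJ => hone' d p g hp (hsocd p hp) hg hgJ
  have haf : a ∈ footprintDeg ord J d := ha ▸ rfl
  have hah : (monomial a (1 : K)).IsHomogeneous d := isHomogeneous_monomial _ haf.2
  have haJ : monomial a (1 : K) ∉ J := monomial_notMem_of_mem_footprint haf.1
  rw [hreg_eq]
  refine ⟨a, ha, hfd, fun i => hspan _ (hfh i) (hfJ i), hspan _ hah haJ, fun i => ?_⟩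
  obtain ⟨c, hc⟩ := hone' d (f i) _ (hfh i) (hsoc i) hah haJ
  refine ⟨c, ?_, ?_⟩
  · rintro rfl
    rw [zero_smul, sub_zero] at hc
    exact hfJ i hc
  · rw [smul_monomial, smul_eq_mul, mul_one] at hc
    refine isRemainder_iff_eq (mem_standardSpan_iff.2 fun b hb => ?_) hc
    classical
    rw [coeff_monomial] at hb
    have hab : a = b := by
      by_contra h0
      exact hb (if_neg h0)
    exact hab ▸ haf.1
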